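/- Let $q$ be a prime power, $n,r,s,t$ positive integers, and $V$ an $n$-dimensional vector space over $\mathbb{F}_q$. For integers $m,k\ge 0$ put ${m \brack k}=\prod_{i=0}^{k-1}\frac{q^{m-i}-1}{q^{k-i}-1}$ (so ${m\brack k}=0$ if $k>m$). For $M\subseteq[n]=\{1,\dots,n\}$ let ${V\brack M}$ be the family of all subspaces of $V$ whose dimension lies in $M$, and write ${V\brack k}={V\brack\{k\}}$. Let $R,S\subseteq[n]$ be non-empty with $r=\max R$, $s=\max S$, $t\le\min(R\cup S)$ and $r+s-t<n$. Let $\mathcal A\subseteq{V\brack R}$ and $\mathcal B\subseteq{V\brack S}$ be non-empty and cross $t$-intersecting, that is, $\dim(A\cap B)\ge t$ for all $A\in\mathcal A$, $B\in\mathcal B$. Then $$|\mathcal A|+|\mathcal B|\le\max\Big\{1+\sum_{i\in S}\sum_{j=t}^{i}q^{(r-j)(i-j)}{r\brack j}{n-r\brack i-j},\ 1+\sum_{i\in R}\sum_{j=t}^{i}q^{(s-j)(i-j)}{s\brack j}{n-s\brack i-j}\Big\}.$$ Moreover, the following hold. (1) If $R=S$, then equality holds if and only if one of the following holds: (i) $\mathcal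 A=\{A\}$ and $\mathcal B=\{B\in{V\brack S}:\dim(B\cap A)\ge t\}$ for some $A\in{V\brack r}$; (ii) $\mathcal B=\{B\}$ and $\mathcal A=\{A\in{V\brack R}:\dim(A\cap B)\ge t\}$ for some $B\in{V\brack s}$. (2) If $R\ne S$ and $s^2+r^2+sr\le n$, then equality holds if and only if one of the following holds, where $R\bigtriangleup S$ is the symmetric difference: (i) $\max(R\bigtriangleup S)\in S$, and $\mathcal A=\{A\}$ and $\mathcal B=\{B\in{V\brack S}:\dim(B\cap A)\ge t\}$ for some $A\in{V\brack r}$; (ii) $\max(R\bigtriangleup S)\in R$, and $\mathcal B=\{B\}$ and $\mathcal A=\{A\in{V\brack R}:\dim(A\cap B)\ge t\}$ for some $B\in{V\brack s}$. -/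

import Mathlib

open Module

/-- The Gaussian binomial coefficient `∏_{i<k} (q^(n-i) - 1) / (q^(k-i) - 1)`, as a rational number.
For `k > n` the factor `i = n` vanishes, so the value is `0`. -/
def gaussBinom (q n k : ℕ) : ℚ :=
  ∏ i ∈ Finset.range k, ((q : ℚ) ^ (n - i) - 1) / ((q : ℚ) ^ (k - i) - 1)

/-- The family of all subspaces of `V` whose dimension belongs to `M`. -/
def subspacesOfDim (F V : Type*) [Field F] [AddCommGroup V] [Module F V] (M : Finset ℕ) :
    Set (Submodule F V) :=
  {W | finrank F W ∈ M}

/-- Two families of subspaces are non-empty cross `t`-intersecting. -/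
structure NonemptyCrossIntersecting {F V : Type*} [Field F] [AddCommGroup V] [Module F V]
    (t : ℕ) (𝒜 ℬ : Set (Submodule F V)) : Prop where
  left_nonempty : 𝒜.Nonempty
  right_nonempty : ℬ.Nonempty
  le_finrank_inf : ∀ A ∈ 𝒜, ∀ B ∈ ℬ, t ≤ finrank F (A ⊓ B : Submodule F V)

/-- `1 + ∑_{i ∈ M} ∑_{j = t}^{i} q^((a-j)(i-j)) [a, j] [n-a, i-j]`, for `a ≤ n`.
Here `i - j` is never truncated, and where `a - j` is (`j > a`), the factor `[a, j]` is zero. -/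
def crossBound (q n t a : ℕ) (M : Finset ℕ) : ℚ :=
  1 + ∑ i ∈ M, ∑ j ∈ Finset.Icc t i,
    (q : ℚ) ^ ((a - j) * (i - j)) * gaussBinom q a j * gaussBinom q (n - a) (i - j)

/-- `𝒜` consists of a single `a`-dimensional subspace `A`, and `ℬ` of all subspaces with dimension
in `M` that meet `A` in dimension at least `t`. -/
def IsTrivialPair {F V : Type*} [Field F] [AddCommGroup V] [Module F V]
    (t a : ℕ) (M : Finset ℕ) (𝒜 ℬ : Set (Submodule F V)) : Prop :=
  ∃ A : Submodule F V, finrank F A = a ∧ 𝒜 = {A} ∧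
    ℬ = {B | B ∈ subspacesOfDim F V M ∧ t ≤ finrank F (B ⊓ A : Submodule F V)}

/-!
For a subspace `A`, let `I(A)` be the family of all subspaces with dimension in `S` that meet `A` in
dimension at least `t`. The theorem follows from two independent facts.

*Every pair `(𝒜, ℬ)` of largest total size has `|𝒜| = 1` or `|ℬ| = 1`*
(`IsMaxCrossPair.isTrivialPair_or`); this needs only `r + s < n + t`. If `(𝒜, ℬ)` and `(𝒜', ℬ')` are
such pairs, then `(𝒜 ∩ 𝒜', ℬ ∪ ℬ')` and `(𝒜 ∪ 𝒜', ℬ ∩ ℬ')` are cross `t`-intersecting and have the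
same total size, hence are again maximal if no family is empty (`IsMaxCrossPair.inter_union`). Let
`1 < |𝒜| ≤ |ℬ|` with `|𝒜|` least possible, and let `g` be a linear automorphism. If `𝒜` meets `g𝒜`,
then by minimality either `g𝒜 = 𝒜` or `𝒜 ∩ g𝒜 = {A}` for some `A`. In the second case maximality
gives `dim A = r` and `ℬ ∪ gℬ = I(A)`. But for `A₁ ∈ 𝒜` and `A₂ ∈ g𝒜` other than `A`, a general
extension of a suitable `t`-dimensional subspace of `A` lies in `I(A)` and meets both `A₁` and `A₂` in
dimension less than `t` (`Submodule.exists_le_finrank_inf_and_lt_and_lt`), so it is in neither `ℬ` nor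
`gℬ`. Hence `𝒜` equals or is disjoint from each of its images. Transvections show that such a family
has only one member (`subsingleton_of_map_eq_or_disjoint`).

*The sizes of the trivial pairs are the two bounds, and for large `n` these differ.* The summands of
`crossBound` count subspaces by their intersection with `A` (`card_finrank_inf_eq`); this is proved by
counting bases adapted to `A`. The counts at least double with each step in dimension, and counting
pairs of an `r`- and an `s`-dimensional subspace compares the layers that belong to different sides
(`crossBound_lt_crossBound`).
-/

/-! ### Subspaces in general position -/

section GeneralPosition

variable {F V : Type*} [Field F] [AddCommGroup V] [Module F V]

theorem Submodule.exists_mem_notMem_notMem {A P Q : Submodule F V} (hP : ¬ A ≤ P) (hQ : ¬ A ≤ Q) :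
    ∃ v ∈ A, v ∉ P ∧ v ∉ Q := by
  obtain ⟨x, hxA, hx⟩ := SetLike.not_le_iff_exists.1 hP
  obtain ⟨y, hyA, hy⟩ := SetLike.not_le_iff_exists.1 hQ
  by_cases hxQ : x ∈ Q
  · by_cases hyP : y ∈ P
    · exact ⟨x + y, A.add_mem hxA hyA, fun h => hx ((P.add_mem_iff_left hyP).1 h),
        fun h => hy ((Q.add_mem_iff_right hxQ).1 h)⟩
    · exact ⟨y, hyA, hyP, hy⟩
  · exact ⟨x, hxA, hx, hxQ⟩

variable [FiniteDimensional F V]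

theorem Submodule.exists_finrank_eq_of_le_of_le {P Q : Submodule F V} (hPQ : P ≤ Q) {k : ℕ}
    (hPk : finrank F P ≤ k) (hkQ : k ≤ finrank F Q) :
    ∃ T : Submodule F V, P ≤ T ∧ T ≤ Q ∧ finrank F T = k := by
  induction k, hPk using Nat.le_induction with
  | base => exact ⟨P, le_rfl, hPQ, rfl⟩
  | succ k hk ih =>
    obtain ⟨T, hPT, hTQ, hT⟩ := ih (by omega)
    have hnot : ¬ Q ≤ T := fun h => by have := Submodule.finrank_mono h; omega
    obtain ⟨v, hvQ, hvT⟩ := SetLike.not_le_iff_exists.1 hnot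
    refine ⟨T ⊔ Submodule.span F {v}, hPT.trans le_sup_left,
      sup_le hTQ ((Submodule.span_singleton_le_iff_mem _ _).2 hvQ), ?_⟩
    rw [Submodule.finrank_sup_span_singleton hvT, hT]

/-- A vector outside a suitable proper subspace can be added to `B` without making the
intersection with `A` reach dimension `t`. -/
theorem Submodule.exists_ne_top_forall_finrank_inf_lt {A B : Submodule F V} {t : ℕ}
    (hB : finrank F B < finrank F V) (hAB : finrank F (B ⊓ A : Submodule F V) < t)
    (hdim : finrank F A + finrank F B + 1 < finrank F V + t) :
    ∃ P : Submodule F V, ¬ ⊤ ≤ P ∧ B ≤ P ∧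
      ∀ v ∉ P, finrank F ((B ⊔ Submodule.span F {v}) ⊓ A : Submodule F V) < t := by
  have key : ∀ v, finrank F ((B ⊔ Submodule.span F {v}) ⊓ A : Submodule F V) ≤
      finrank F (B ⊓ A : Submodule F V) + 1 := by
    intro v
    have h1 := Submodule.finrank_sup_add_finrank_inf_eq (B ⊔ Submodule.span F {v}) A
    have h2 := Submodule.finrank_sup_add_finrank_inf_eq B A
    have h3 := Submodule.finrank_add_le_finrank_add_finrank B (Submodule.span F {v})
    have h4 : finrank F (Submodule.span F {v}) ≤ 1 := by
      simpa using finrank_span_le_card (R := F) ({v} : Set V)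
    have h5 : finrank F (B ⊔ A : Submodule F V) ≤
        finrank F ((B ⊔ Submodule.span F {v}) ⊔ A : Submodule F V) :=
      Submodule.finrank_mono (sup_le_sup_right le_sup_left _)
    omega
  by_cases hlt : finrank F (B ⊓ A : Submodule F V) + 1 < t
  · refine ⟨B, fun h => ?_, le_rfl, fun v _ => (key v).trans_lt hlt⟩
    have := Submodule.finrank_mono h
    rw [finrank_top] at this
    omega
  · have h2 := Submodule.finrank_sup_add_finrank_inf_eq B A
    refine ⟨B ⊔ A, fun h => ?_, le_sup_left, fun v hv => ?_⟩
    · have := Submodule.finrank_mono h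
      rw [finrank_top] at this
      omega
    · have h1 := Submodule.finrank_sup_add_finrank_inf_eq (B ⊔ Submodule.span F {v}) A
      have h3 := Submodule.finrank_sup_span_singleton (fun h => hv (Submodule.mem_sup_left h))
      have h4 := Submodule.finrank_sup_span_singleton hv
      rw [sup_right_comm] at h1
      omega

/-- If `A` lies in neither `A₁` nor `A₂`, some `s`-dimensional subspace meets `A`, but neither `A₁`
nor `A₂`, in dimension at least `t`. It is obtained by extending a `t`-dimensional subspace of `A`
that lies in neither `A₁` nor `A₂` by vectors in general position. -/
theorem Submodule.exists_le_finrank_inf_and_lt_and_lt {A A₁ A₂ : Submodule F V} {r s t : ℕ}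
    (ht : 0 < t) (htA : t ≤ finrank F A) (hts : t ≤ s) (hrst : r + s < finrank F V + t)
    (hA : finrank F A ≤ r) (h₁r : finrank F A₁ ≤ r) (h₂r : finrank F A₂ ≤ r)
    (h₁ : ¬ A ≤ A₁) (h₂ : ¬ A ≤ A₂) :
    ∃ B : Submodule F V, finrank F B = s ∧ t ≤ finrank F (B ⊓ A : Submodule F V) ∧
      finrank F (B ⊓ A₁ : Submodule F V) < t ∧ finrank F (B ⊓ A₂ : Submodule F V) < t := by
  obtain ⟨v, hvA, hv₁, hv₂⟩ := Submodule.exists_mem_notMem_notMem h₁ h₂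
  obtain ⟨T, hvT, hTA, hT⟩ := Submodule.exists_finrank_eq_of_le_of_le (k := t)
    ((Submodule.span_singleton_le_iff_mem v A).2 hvA)
    (((finrank_span_le_card ({v} : Set V)).trans_eq (by simp)).trans ht) htA
  rw [Submodule.span_singleton_le_iff_mem] at hvT
  have hsmall : ∀ C : Submodule F V, v ∉ C → finrank F (T ⊓ C : Submodule F V) < t := by
    intro C hvC
    rw [← hT]
    exact Submodule.finrank_lt_finrank_of_lt
      (lt_of_le_of_ne inf_le_left fun h => hvC ((inf_eq_left.1 h) hvT))
  suffices h : ∀ k, t ≤ k → k ≤ s → ∃ B : Submodule F V, finrank F B = k ∧ T ≤ B ∧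
      finrank F (B ⊓ A₁ : Submodule F V) < t ∧ finrank F (B ⊓ A₂ : Submodule F V) < t by
    obtain ⟨B, hB, hTB, hB₁, hB₂⟩ := h s hts le_rfl
    exact ⟨B, hB, hT.symm.le.trans (Submodule.finrank_mono (le_inf hTB hTA)), hB₁, hB₂⟩
  intro k hk
  induction k, hk using Nat.le_induction with
  | base => exact fun _ => ⟨T, hT, le_rfl, hsmall _ hv₁, hsmall _ hv₂⟩
  | succ k hk ih =>
    intro hks
    obtain ⟨B, hB, hTB, hB₁, hB₂⟩ := ih (by omega)
    obtain ⟨P, hP, hBP, hPv⟩ := Submodule.exists_ne_top_forall_finrank_inf_lt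
      (by omega) hB₁ (by omega)
    obtain ⟨Q, hQ, -, hQv⟩ := Submodule.exists_ne_top_forall_finrank_inf_lt
      (by omega) hB₂ (by omega)
    obtain ⟨w, -, hwP, hwQ⟩ := Submodule.exists_mem_notMem_notMem hP hQ
    exact ⟨B ⊔ Submodule.span F {w},
      by rw [Submodule.finrank_sup_span_singleton (fun h => hwP (hBP h)), hB],
      hTB.trans le_sup_left, hPv w hwP, hQv w hwQ⟩

end GeneralPosition

/-! ### Families of subspaces that are blocks of the general linear group -/

section Blocks

variable {F V : Type*} [Field F] [AddCommGroup V] [Module F V]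

theorem Submodule.notMem_sup_span_singleton {P Q : Submodule F V} {v w : V} (hPQ : P ≤ Q)
    (hwQ : w ∈ Q) (hv : v ∉ Q) (hw : w ∉ P) : w ∉ P ⊔ Submodule.span F {v} := by
  rw [Submodule.mem_sup]
  rintro ⟨a, ha, b, hb, hab⟩
  obtain ⟨c, rfl⟩ := Submodule.mem_span_singleton.1 hb
  by_cases hc : c = 0
  · rw [hc, zero_smul, add_zero] at hab
    exact hw (hab ▸ ha)
  · refine hv ((Submodule.smul_mem_iff _ hc).1 ?_)
    rw [← eq_sub_iff_add_eq'] at hab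
    exact hab ▸ Q.sub_mem hwQ (hPQ ha)

/-- A transvection `x ↦ x + f x • v` with `f w = 1` that fixes `P` and `v`. -/
theorem exists_transvection_of_notMem {P : Submodule F V} {v w : V}
    (hw : w ∉ P ⊔ Submodule.span F {v}) :
    ∃ (f : Dual F V) (hf : f v = 0), f w = 1 ∧ P ≤ LinearMap.ker f ∧
      ∀ x, LinearEquiv.transvection hf x = x + f x • v := by
  obtain ⟨f, hfw, hf⟩ := Submodule.exists_le_ker_of_notMem hw
  have hv : v ∈ LinearMap.ker f := hf (Submodule.mem_sup_right (Submodule.mem_span_singleton_self v))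
  refine ⟨(f w)⁻¹ • f, ?_, ?_, ?_, ?_⟩
  · simp [LinearMap.mem_ker.1 hv]
  · simp [hfw]
  · intro x hx
    have : f x = 0 := LinearMap.mem_ker.1 (hf (Submodule.mem_sup_left hx))
    simp [this]
  · intro x
    rw [LinearEquiv.transvection.apply]

theorem map_transvection_eq_of_le_ker {A : Submodule F V} {f : Dual F V} {v : V} (hf : f v = 0)
    (hA : A ≤ LinearMap.ker f) :
    A.map (LinearEquiv.transvection hf : V →ₗ[F] V) = A := by
  ext x
  simp only [Submodule.mem_map, LinearEquiv.coe_coe, LinearEquiv.transvection.apply]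
  constructor
  · rintro ⟨y, hy, rfl⟩
    rw [LinearMap.mem_ker.1 (hA hy)]
    simpa using hy
  · intro hx
    exact ⟨x, hx, by rw [LinearMap.mem_ker.1 (hA hx)]; simp⟩

theorem map_transvection_eq_of_mem {A : Submodule F V} {f : Dual F V} {v : V} (hf : f v = 0)
    (hA : v ∈ A) :
    A.map (LinearEquiv.transvection hf : V →ₗ[F] V) = A := by
  ext x
  simp only [Submodule.mem_map, LinearEquiv.coe_coe, LinearEquiv.transvection.apply]
  constructor
  · rintro ⟨y, hy, rfl⟩
    exact A.add_mem hy (A.smul_mem _ hA)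
  · intro hx
    refine ⟨x - f x • v, A.sub_mem hx (A.smul_mem _ hA), ?_⟩
    simp [hf]

/-- A family of subspaces that is disjoint from or equal to each of its images under the general
linear group has at most one member, if some `B` meets every member non-trivially and spans the
whole space together with none. This replaces the primitivity of the action of the general linear
group on the subspaces of a given dimension. -/
theorem subsingleton_of_map_eq_or_disjoint [FiniteDimensional F V] {𝒜 : Set (Submodule F V)}
    (h𝒜 : ∀ g : V ≃ₗ[F] V, ∀ A ∈ 𝒜, A.map (g : V →ₗ[F] V) ∈ 𝒜 →
      ∀ A' ∈ 𝒜, A'.map (g : V →ₗ[F] V) ∈ 𝒜)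
    {B : Submodule F V} (hinf : ∀ A ∈ 𝒜, A ⊓ B ≠ ⊥) (hsup : ∀ A ∈ 𝒜, A ⊔ B ≠ ⊤) :
    𝒜.Subsingleton := by
  rcases 𝒜.eq_empty_or_nonempty with rfl | hne
  · exact Set.subsingleton_empty
  -- Choose a member whose intersection with `B` has least dimension.
  obtain ⟨m, ⟨A, hA, hAm⟩, hmin⟩ := WellFounded.has_min (wellFounded_lt (α := ℕ))
    ((fun A : Submodule F V => finrank F (A ⊓ B : Submodule F V)) '' 𝒜) (hne.image _)
  have hmin' : ∀ A' ∈ 𝒜, ¬ finrank F (A' ⊓ B : Submodule F V) <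
      finrank F (A ⊓ B : Submodule F V) := fun A' hA' h => by
    have h' : (fun A : Submodule F V => finrank F (A ⊓ B : Submodule F V)) A = m := hAm
    exact hmin _ (Set.mem_image_of_mem _ hA') (h' ▸ h)
  -- A transvection along a vector outside `A + B` that moves `A ∩ B` lowers this dimension.
  have hlower : ∀ (f : Dual F V) (v : V) (hf : f v = 0) (w : V), v ∉ A ⊔ B → w ∈ A ⊓ B →
      f w = 1 → A.map (LinearEquiv.transvection hf : V →ₗ[F] V) ∉ 𝒜 := by
    intro f v hf w hv hw hfw hmem
    refine hmin' _ hmem (Submodule.finrank_lt_finrank_of_lt ?_)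
    have hle : A.map (LinearEquiv.transvection hf : V →ₗ[F] V) ⊓ B ≤
        (A ⊓ B) ⊓ LinearMap.ker f := by
      rintro x ⟨hx, hxB⟩
      obtain ⟨y, hy, rfl⟩ := Submodule.mem_map.1 hx
      simp only [LinearEquiv.coe_coe, LinearEquiv.transvection.apply] at hxB ⊢
      have hfy : f y = 0 := by
        by_contra h0
        refine hv ?_
        have : f y • v ∈ A ⊔ B := by
          have h1 : (y + f y • v) - y ∈ A ⊔ B :=
            Submodule.sub_mem _ (Submodule.mem_sup_right hxB) (Submodule.mem_sup_left hy)
          simpa using h1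
        exact (Submodule.smul_mem_iff _ h0).1 this
      rw [hfy, zero_smul, add_zero] at hxB ⊢
      exact ⟨⟨hy, hxB⟩, hfy⟩
    refine lt_of_le_of_ne (hle.trans inf_le_left) fun h => ?_
    have : w ∈ LinearMap.ker f := (hle (h.symm ▸ hw)).2
    rw [LinearMap.mem_ker, hfw] at this
    exact one_ne_zero this
  obtain ⟨v₀, hv₀⟩ : ∃ v, v ∉ A ⊔ B := by
    by_contra! h
    exact hsup A hA (eq_top_iff.2 fun x _ => h x)
  obtain ⟨w₀, hw₀, hw₀0⟩ := (Submodule.ne_bot_iff _).1 (hinf A hA)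
  have hle_sup : ∀ A' ∈ 𝒜, A' ≤ A ⊔ B := by
    intro A' hA' v hvA'
    by_contra hv
    obtain ⟨f, hf, hfw, -, -⟩ := exists_transvection_of_notMem
      (Submodule.notMem_sup_span_singleton bot_le (Submodule.mem_sup_left hw₀.1) hv
        (by simpa using hw₀0))
    refine hlower f v hf w₀ hv hw₀ hfw (h𝒜 _ A' hA' ?_ A hA)
    rwa [map_transvection_eq_of_mem hf hvA']
  have hinf_le : ∀ A' ∈ 𝒜, A ⊓ B ≤ A' := by
    intro A' hA' w hw
    by_contra hwA'
    obtain ⟨f, hf, hfw, hker, -⟩ := exists_transvection_of_notMem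
      (Submodule.notMem_sup_span_singleton (hle_sup A' hA') (Submodule.mem_sup_left hw.1) hv₀ hwA')
    refine hlower f v₀ hf w hv₀ hw hfw (h𝒜 _ A' hA' ?_ A hA)
    rwa [map_transvection_eq_of_le_ker hf hker]
  -- Transvections that fix `A` would now move any other member out of this range.
  have hA_le : ∀ A' ∈ 𝒜, A ≤ A' := by
    intro A' hA' u hu
    by_contra huA'
    have hw₀A' := hinf_le A' hA' hw₀
    obtain ⟨f, hf, hfw, -, hT⟩ := exists_transvection_of_notMem
      (Submodule.notMem_sup_span_singleton bot_le hw₀A' huA' (by simpa using hw₀0))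
    have hmem := h𝒜 (LinearEquiv.transvection hf) A hA
      (by rwa [map_transvection_eq_of_mem hf hu]) A' hA'
    obtain ⟨y, hy, hyw⟩ := Submodule.mem_map.1 (hinf_le _ hmem hw₀)
    rw [LinearEquiv.coe_coe, hT] at hyw
    have hfy : f y = 1 := by
      have := congrArg f hyw
      simpa [hf, hfw] using this
    rw [hfy, one_smul, ← eq_sub_iff_add_eq'] at hyw
    exact huA' (hyw ▸ A'.sub_mem hw₀A' hy)
  have hle_A : ∀ A' ∈ 𝒜, A' ≤ A := by
    intro A' hA' u hu
    by_contra huA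
    have huAB := hle_sup A' hA' hu
    obtain ⟨f, hf, hfu, hker, hT⟩ := exists_transvection_of_notMem
      (Submodule.notMem_sup_span_singleton le_sup_left huAB hv₀ huA)
    have hmem := h𝒜 (LinearEquiv.transvection hf) A hA
      (by rwa [map_transvection_eq_of_le_ker hf hker]) A' hA'
    have := hle_sup _ hmem (Submodule.mem_map_of_mem hu)
    rw [LinearEquiv.coe_coe, hT, hfu, one_smul] at this
    exact hv₀ ((Submodule.add_mem_iff_right _ huAB).1 this)
  have hall : ∀ A' ∈ 𝒜, A' = A := fun A' hA' => le_antisymm (hle_A A' hA') (hA_le A' hA')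
  exact fun A₁ h₁ A₂ h₂ => (hall A₁ h₁).trans (hall A₂ h₂).symm

end Blocks

/-! ### Extremal cross-intersecting pairs -/

section Extremal

variable {F V : Type*} [Field F] [AddCommGroup V] [Module F V]

/-- The subspaces with dimension in `M` that meet `A` in dimension at least `t`. -/
def meeting (t : ℕ) (M : Finset ℕ) (A : Submodule F V) : Set (Submodule F V) :=
  {B | B ∈ subspacesOfDim F V M ∧ t ≤ finrank F (B ⊓ A : Submodule F V)}

/-- `𝒜` and `ℬ` are non-empty cross `t`-intersecting families of subspaces with dimensions in `R`
and `S` respectively. -/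
structure IsCrossPair (t : ℕ) (R S : Finset ℕ) (𝒜 ℬ : Set (Submodule F V)) : Prop where
  left_subset : 𝒜 ⊆ subspacesOfDim F V R
  right_subset : ℬ ⊆ subspacesOfDim F V S
  cross : NonemptyCrossIntersecting t 𝒜 ℬ

/-- A pair of non-empty cross `t`-intersecting families for which the sum of the two sizes is as
large as possible. -/
structure IsMaxCrossPair (t : ℕ) (R S : Finset ℕ) (𝒜 ℬ : Set (Submodule F V)) : Prop extends
    IsCrossPair t R S 𝒜 ℬ where
  ncard_add_le : ∀ 𝒜' ℬ' : Set (Submodule F V), IsCrossPair t R S 𝒜' ℬ' →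
    𝒜'.ncard + ℬ'.ncard ≤ 𝒜.ncard + ℬ.ncard

variable {t r s : ℕ} {R S : Finset ℕ} {𝒜 ℬ 𝒜' ℬ' : Set (Submodule F V)}

theorem IsCrossPair.swap (h : IsCrossPair t R S 𝒜 ℬ) : IsCrossPair t S R ℬ 𝒜 where
  left_subset := h.right_subset
  right_subset := h.left_subset
  cross := ⟨h.cross.right_nonempty, h.cross.left_nonempty,
    fun A hA B hB => inf_comm A B ▸ h.cross.le_finrank_inf B hB A hA⟩

theorem IsMaxCrossPair.swap (h : IsMaxCrossPair t R S 𝒜 ℬ) : IsMaxCrossPair t S R ℬ 𝒜 where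
  toIsCrossPair := h.toIsCrossPair.swap
  ncard_add_le 𝒜' ℬ' h' := by
    have := h.ncard_add_le _ _ h'.swap
    omega

theorem IsCrossPair.subset_meeting (h : IsCrossPair t R S 𝒜 ℬ) {A : Submodule F V} (hA : A ∈ 𝒜) :
    ℬ ⊆ meeting t S A :=
  fun B hB => ⟨h.right_subset hB, inf_comm A B ▸ h.cross.le_finrank_inf A hA B hB⟩

theorem IsCrossPair.inter_union (h : IsCrossPair t R S 𝒜 ℬ) (h' : IsCrossPair t R S 𝒜' ℬ')
    (hne : (𝒜 ∩ 𝒜').Nonempty) : IsCrossPair t R S (𝒜 ∩ 𝒜') (ℬ ∪ ℬ') where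
  left_subset := Set.inter_subset_left.trans h.left_subset
  right_subset := Set.union_subset h.right_subset h'.right_subset
  cross := ⟨hne, h.cross.right_nonempty.inl, fun A hA B hB =>
    hB.elim (h.cross.le_finrank_inf A hA.1 B) (h'.cross.le_finrank_inf A hA.2 B)⟩

/-- The image of a family of subspaces under a linear automorphism of the space. -/
def mapFamily (g : V ≃ₗ[F] V) (𝒜 : Set (Submodule F V)) : Set (Submodule F V) :=
  (fun A => A.map (g : V →ₗ[F] V)) '' 𝒜

theorem ncard_mapFamily (g : V ≃ₗ[F] V) (𝒜 : Set (Submodule F V)) :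
    (mapFamily g 𝒜).ncard = 𝒜.ncard :=
  Set.ncard_image_of_injective _ (Submodule.map_injective_of_injective g.injective)

theorem IsCrossPair.map (h : IsCrossPair t R S 𝒜 ℬ) (g : V ≃ₗ[F] V) :
    IsCrossPair t R S (mapFamily g 𝒜) (mapFamily g ℬ) where
  left_subset := by
    rintro _ ⟨A, hA, rfl⟩
    have := h.left_subset hA
    simp only [subspacesOfDim, Set.mem_ofPred_eq] at this ⊢
    rwa [LinearEquiv.finrank_map_eq]
  right_subset := by
    rintro _ ⟨A, hA, rfl⟩
    have := h.right_subset hA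
    simp only [subspacesOfDim, Set.mem_ofPred_eq] at this ⊢
    rwa [LinearEquiv.finrank_map_eq]
  cross := by
    refine ⟨h.cross.left_nonempty.image _, h.cross.right_nonempty.image _, ?_⟩
    rintro _ ⟨A, hA, rfl⟩ _ ⟨B, hB, rfl⟩
    simp only
    rw [← Submodule.map_inf _ g.injective, LinearEquiv.finrank_map_eq]
    exact h.cross.le_finrank_inf A hA B hB

theorem IsMaxCrossPair.map (h : IsMaxCrossPair t R S 𝒜 ℬ) (g : V ≃ₗ[F] V) :
    IsMaxCrossPair t R S (mapFamily g 𝒜) (mapFamily g ℬ) where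
  toIsCrossPair := h.toIsCrossPair.map g
  ncard_add_le 𝒜' ℬ' h' := by
    rw [ncard_mapFamily, ncard_mapFamily]
    exact h.ncard_add_le _ _ h'

theorem isCrossPair_singleton_meeting {A : Submodule F V} (hA : finrank F A ∈ R)
    (hne : (meeting t S A).Nonempty) : IsCrossPair t R S {A} (meeting t S A) where
  left_subset := by simpa [subspacesOfDim] using hA
  right_subset := fun B hB => hB.1
  cross := ⟨Set.singleton_nonempty A, hne, by
    rintro _ rfl B hB
    exact inf_comm B _ ▸ hB.2⟩

variable [FiniteDimensional F V]

theorem meeting_mono {A A' : Submodule F V} (h : A ≤ A') : meeting t S A ⊆ meeting t S A' :=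
  fun _ hB => ⟨hB.1, hB.2.trans (Submodule.finrank_mono (inf_le_inf_left _ h))⟩

theorem exists_mem_meeting_notMem_notMem (ht : 0 < t) (htS : t ≤ s) (hs : s ∈ S)
    (hrst : r + s < finrank F V + t) {A A₁ A₂ : Submodule F V}
    (htA : t ≤ finrank F A) (hA : finrank F A ≤ r) (h₁r : finrank F A₁ ≤ r)
    (h₂r : finrank F A₂ ≤ r) (h₁ : ¬ A ≤ A₁) (h₂ : ¬ A ≤ A₂) :
    ∃ B ∈ meeting t S A, B ∉ meeting t S A₁ ∧ B ∉ meeting t S A₂ := by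
  obtain ⟨B, hBs, hB, hB₁, hB₂⟩ :=
    Submodule.exists_le_finrank_inf_and_lt_and_lt ht htA htS hrst hA h₁r h₂r h₁ h₂
  have hBS : B ∈ subspacesOfDim F V S := by simpa [subspacesOfDim, hBs] using hs
  exact ⟨B, ⟨hBS, hB⟩, fun h => hB₁.not_ge h.2, fun h => hB₂.not_ge h.2⟩

theorem meeting_nonempty (htS : t ≤ s) (hs : s ∈ S) (hsV : s ≤ finrank F V) {A : Submodule F V}
    (htA : t ≤ finrank F A) : (meeting t S A).Nonempty := by
  obtain ⟨T, -, hTA, hT⟩ := Submodule.exists_finrank_eq_of_le_of_le (bot_le : ⊥ ≤ A)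
    (by simp) htA
  obtain ⟨B, hTB, -, hB⟩ := Submodule.exists_finrank_eq_of_le_of_le (le_top : T ≤ ⊤)
    (hT.trans_le htS) (by rwa [finrank_top])
  refine ⟨B, by simpa [subspacesOfDim, hB] using hs, ?_⟩
  exact hT.symm.le.trans (Submodule.finrank_mono (le_inf hTB hTA))

variable [Finite F]

theorem finite_submodule (F V : Type*) [Field F] [AddCommGroup V] [Module F V] [Finite F]
    [FiniteDimensional F V] : Finite (Submodule F V) :=
  have : Finite V := Module.finite_of_finite F
  inferInstance

/-- Maximal pairs are closed under intersecting the left and uniting the right families: the pair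
`(𝒜 ∩ 𝒜', ℬ ∪ ℬ')` and the pair `(𝒜 ∪ 𝒜', ℬ ∩ ℬ')` have together as many members as the two given
pairs. The assumption on the sizes ensures that `ℬ ∩ ℬ'` is not empty. -/
theorem IsMaxCrossPair.inter_union (h : IsMaxCrossPair t R S 𝒜 ℬ)
    (h' : IsMaxCrossPair t R S 𝒜' ℬ') (hne : (𝒜 ∩ 𝒜').Nonempty) (hle : 𝒜.ncard ≤ ℬ'.ncard) :
    IsMaxCrossPair t R S (𝒜 ∩ 𝒜') (ℬ ∪ ℬ') := by
  have := finite_submodule F V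
  have hpair := h.toIsCrossPair.inter_union h'.toIsCrossPair hne
  refine ⟨hpair, fun 𝒞 𝒟 hCD => (h.ncard_add_le _ _ hCD).trans ?_⟩
  have hA := Set.ncard_union_add_ncard_inter 𝒜 𝒜'
  have hB := Set.ncard_union_add_ncard_inter ℬ ℬ'
  have hpos : 0 < (𝒜 ∩ 𝒜').ncard := (Set.ncard_pos (Set.toFinite _)).2 hne
  have hle₁ := h.ncard_add_le _ _ hpair
  have hle₂ := h.ncard_add_le _ _ h'.toIsCrossPair
  have hle₃ := h'.ncard_add_le _ _ h.toIsCrossPair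
  have hne' : (ℬ' ∩ ℬ).Nonempty := by
    rw [Set.nonempty_iff_ne_empty]
    intro h0
    rw [Set.inter_comm, h0, Set.ncard_empty] at hB
    omega
  have hpair' := (h'.toIsCrossPair.swap.inter_union h.toIsCrossPair.swap hne').swap
  have := h.ncard_add_le _ _ hpair'
  rw [Set.union_comm, Set.inter_comm ℬ'] at this
  omega

theorem ncard_meeting_lt_of_lt (ht : 0 < t) (htS : t ≤ s) (hs : s ∈ S)
    (hrst : r + s < finrank F V + t) {A A' : Submodule F V} (htA' : t ≤ finrank F A')
    (hA' : finrank F A' ≤ r) (hlt : A < A') :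
    (meeting t S A).ncard < (meeting t S A').ncard := by
  have := finite_submodule F V
  have hA : finrank F A ≤ r := (Submodule.finrank_mono hlt.le).trans hA'
  obtain ⟨B, hB, hB', -⟩ := exists_mem_meeting_notMem_notMem ht htS hs hrst htA' hA' hA hA
    hlt.not_ge hlt.not_ge
  exact Set.ncard_lt_ncard ⟨meeting_mono hlt.le, fun h => hB' (h hB)⟩ (Set.toFinite _)

/-- In a maximal pair with `𝒜 = {A}`, the subspace `A` has the largest admissible dimension and `ℬ`
is the family of all subspaces that meet `A` in dimension at least `t`. -/
theorem IsMaxCrossPair.finrank_eq_and_eq_meeting {A : Submodule F V}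
    (h : IsMaxCrossPair t R S {A} ℬ) (ht : 0 < t) (htR : ∀ i ∈ R, t ≤ i) (htS : t ≤ s)
    (hR : IsGreatest (R : Set ℕ) r) (hs : s ∈ S) (hsV : s ≤ finrank F V)
    (hrst : r + s < finrank F V + t) :
    finrank F A = r ∧ ℬ = meeting t S A := by
  have := finite_submodule F V
  have hAR : finrank F A ∈ R := h.left_subset rfl
  have hAr : finrank F A ≤ r := hR.2 hAR
  have htA := htR _ hAR
  have hsub := h.subset_meeting (Set.mem_singleton A)
  have hmax : ∀ A' : Submodule F V, finrank F A' ∈ R →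
      (meeting t S A').ncard ≤ ℬ.ncard := by
    intro A' hA'
    have := h.ncard_add_le _ _ (isCrossPair_singleton_meeting hA'
      (meeting_nonempty htS hs hsV (htR _ hA')))
    simpa using this
  refine ⟨?_, Set.eq_of_subset_of_ncard_le hsub (hmax A hAR) (Set.toFinite _)⟩
  by_contra hne
  obtain ⟨A', hAA', -, hA'⟩ := Submodule.exists_finrank_eq_of_le_of_le (le_top : A ≤ ⊤) hAr
    (by rw [finrank_top]; omega)
  have hlt : A < A' := lt_of_le_of_ne hAA' (by rintro rfl; exact hne hA')
  have h₁ := ncard_meeting_lt_of_lt ht htS hs hrst (hA' ▸ htR _ hR.1) hA'.le hlt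
  have h₂ := hmax A' (hA' ▸ hR.1)
  have h₃ := Set.ncard_le_ncard hsub (Set.toFinite _)
  omega

/-- There is no maximal pair with `1 < |𝒜| ≤ |ℬ|`. In a smallest counterexample, `𝒜` and an image
`g𝒜` that meet without being equal have just one common member `A`, by minimality. Then every
subspace that meets `A` in dimension at least `t` lies in `ℬ ∪ gℬ`, which is refuted by one that
meets some other members of `𝒜` and of `g𝒜` in smaller dimension. So `𝒜` is a block of the general
linear group. -/
theorem not_one_lt_ncard_le (ht : 0 < t) (htR : ∀ i ∈ R, t ≤ i) (htS : ∀ i ∈ S, t ≤ i)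
    (hR : IsGreatest (R : Set ℕ) r) (hS : IsGreatest (S : Set ℕ) s) (hsV : s ≤ finrank F V)
    (hrst : r + s < finrank F V + t) (N : ℕ) :
    ∀ 𝒜 ℬ : Set (Submodule F V), IsMaxCrossPair t R S 𝒜 ℬ → 𝒜.ncard = N → 1 < N →
      N ≤ ℬ.ncard → False := by
  have := finite_submodule F V
  induction N using Nat.strong_induction_on with
  | _ N ih =>
  rintro 𝒜 ℬ h rfl h1 hle
  have hdim : ∀ 𝒜' ℬ' : Set (Submodule F V), IsMaxCrossPair t R S 𝒜' ℬ' → ∀ A ∈ 𝒜',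
      finrank F A ≤ r := fun 𝒜' ℬ' h' A hA => hR.2 (h'.left_subset hA)
  have hblock : ∀ g : V ≃ₗ[F] V, (𝒜 ∩ mapFamily g 𝒜).Nonempty → 𝒜 ⊆ mapFamily g 𝒜 := by
    intro g hne
    have hmap := h.map g
    have hint := h.inter_union hmap hne (by rwa [ncard_mapFamily])
    have hpos : 0 < (𝒜 ∩ mapFamily g 𝒜).ncard := (Set.ncard_pos (Set.toFinite _)).2 hne
    have hleA : (𝒜 ∩ mapFamily g 𝒜).ncard ≤ 𝒜.ncard :=
      Set.ncard_le_ncard Set.inter_subset_left (Set.toFinite _)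
    have hleB : ℬ.ncard ≤ (ℬ ∪ mapFamily g ℬ).ncard :=
      Set.ncard_le_ncard Set.subset_union_left (Set.toFinite _)
    rcases Nat.eq_or_lt_of_le hleA with heq | hlt
    · have := Set.eq_of_subset_of_ncard_le Set.inter_subset_left heq.ge (Set.toFinite _)
      exact Set.inter_eq_left.1 this
    by_cases hone : 1 < (𝒜 ∩ mapFamily g 𝒜).ncard
    · exact (ih _ hlt _ _ hint rfl hone (by omega)).elim
    exfalso
    obtain ⟨A, hA⟩ := Set.ncard_eq_one.1 (le_antisymm (not_lt.1 hone) hpos)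
    have hAmem : A ∈ 𝒜 ∩ mapFamily g 𝒜 := hA ▸ Set.mem_singleton A
    rw [hA] at hint
    obtain ⟨hAr, hmeet⟩ := hint.finrank_eq_and_eq_meeting ht htR (htS s hS.1) hR hS.1 hsV hrst
    obtain ⟨A₁, hA₁, hne₁⟩ := Set.exists_ne_of_one_lt_ncard h1 A
    obtain ⟨A₂, hA₂, hne₂⟩ := Set.exists_ne_of_one_lt_ncard
      (by rwa [ncard_mapFamily] : 1 < (mapFamily g 𝒜).ncard) A
    have hnle : ∀ A' : Submodule F V, finrank F A' ≤ r → A' ≠ A → ¬ A ≤ A' := fun A' hA' hne hle' =>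
      hne (Submodule.eq_of_le_of_finrank_le hle' (by omega)).symm
    have hr₁ := hdim _ _ h A₁ hA₁
    have hr₂ := hdim _ _ hmap A₂ hA₂
    obtain ⟨B, hB, hB₁, hB₂⟩ := exists_mem_meeting_notMem_notMem ht (htS s hS.1) hS.1 hrst
      (hAr ▸ htR r hR.1) hAr.le hr₁ hr₂ (hnle _ hr₁ hne₁) (hnle _ hr₂ hne₂)
    rw [← hmeet] at hB
    exact hB.elim (fun hB => hB₁ (h.subset_meeting hA₁ hB))
      (fun hB => hB₂ (hmap.subset_meeting hA₂ hB))
  obtain ⟨B, hB⟩ := h.cross.right_nonempty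
  have hsubs : 𝒜.Subsingleton := by
    refine subsingleton_of_map_eq_or_disjoint (B := B) (fun g A hA hgA A' hA' => ?_)
      (fun A hA h0 => ?_) (fun A hA h0 => ?_)
    · have hsub := hblock g ⟨_, hgA, Set.mem_image_of_mem _ hA⟩
      have heq := Set.eq_of_subset_of_ncard_le hsub (ncard_mapFamily g 𝒜).le (Set.toFinite _)
      rw [heq]
      exact Set.mem_image_of_mem _ hA'
    · have := h.cross.le_finrank_inf A hA B hB
      rw [h0, finrank_bot] at this
      omega
    · have h₁ := h.cross.le_finrank_inf A hA B hB
      have h₂ := Submodule.finrank_sup_add_finrank_inf_eq A B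
      have h₃ := hdim _ _ h A hA
      have h₄ : finrank F B ≤ s := hS.2 (h.right_subset hB)
      rw [h0, finrank_top] at h₂
      omega
  have := (Set.ncard_le_one (Set.toFinite 𝒜)).2 (fun A hA A' hA' => hsubs hA hA')
  omega

/-- Every maximal pair is trivial. -/
theorem IsMaxCrossPair.isTrivialPair_or (h : IsMaxCrossPair t R S 𝒜 ℬ) (ht : 0 < t)
    (htR : ∀ i ∈ R, t ≤ i) (htS : ∀ i ∈ S, t ≤ i) (hR : IsGreatest (R : Set ℕ) r)
    (hS : IsGreatest (S : Set ℕ) s) (hrV : r ≤ finrank F V) (hsV : s ≤ finrank F V)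
    (hrst : r + s < finrank F V + t) :
    IsTrivialPair t r S 𝒜 ℬ ∨ IsTrivialPair t s R ℬ 𝒜 := by
  have := finite_submodule F V
  have hA : 0 < 𝒜.ncard := (Set.ncard_pos (Set.toFinite _)).2 h.cross.left_nonempty
  have hB : 0 < ℬ.ncard := (Set.ncard_pos (Set.toFinite _)).2 h.cross.right_nonempty
  have hsr : s + r < finrank F V + t := by omega
  have hone : 𝒜.ncard = 1 ∨ ℬ.ncard = 1 := by
    by_contra! hne
    rcases le_total 𝒜.ncard ℬ.ncard with hle | hle
    · exact not_one_lt_ncard_le ht htR htS hR hS hsV hrst _ _ _ h rfl (by omega) hle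
    · exact not_one_lt_ncard_le ht htS htR hS hR hrV hsr _ _ _ h.swap rfl (by omega) hle
  rcases hone with hone | hone
  · obtain ⟨A, rfl⟩ := Set.ncard_eq_one.1 hone
    obtain ⟨hr, hmeet⟩ := h.finrank_eq_and_eq_meeting ht htR (htS s hS.1) hR hS.1 hsV hrst
    exact Or.inl ⟨A, hr, rfl, hmeet⟩
  · obtain ⟨B, rfl⟩ := Set.ncard_eq_one.1 hone
    obtain ⟨hs, hmeet⟩ := h.swap.finrank_eq_and_eq_meeting ht htS (htR r hR.1) hS hR.1 hrV hsr
    exact Or.inr ⟨B, hs, rfl, hmeet⟩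

theorem IsCrossPair.exists_isMaxCrossPair (h : IsCrossPair t R S 𝒜 ℬ) :
    ∃ 𝒜' ℬ' : Set (Submodule F V), IsMaxCrossPair t R S 𝒜' ℬ' := by
  have := finite_submodule F V
  obtain ⟨⟨𝒜', ℬ'⟩, h', hmax⟩ := Set.exists_max_image
    {p : Set (Submodule F V) × Set (Submodule F V) | IsCrossPair t R S p.1 p.2}
    (fun p => p.1.ncard + p.2.ncard) (Set.toFinite _) ⟨(𝒜, ℬ), h⟩
  exact ⟨𝒜', ℬ', h', fun 𝒞 𝒟 hCD => hmax (𝒞, 𝒟) hCD⟩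

end Extremal

/-! ### Counting subspaces by their intersection with a fixed subspace -/

section Counting

theorem prod_range_pow_sub_pow_eq_zero (q : ℚ) {n k : ℕ} (h : n < k) :
    ∏ i ∈ Finset.range k, (q ^ n - q ^ i) = 0 :=
  Finset.prod_eq_zero (Finset.mem_range.2 h) (sub_self _)

theorem gaussBinom_eq_zero {q n k : ℕ} (h : n < k) : gaussBinom q n k = 0 :=
  Finset.prod_eq_zero (Finset.mem_range.2 h) (by simp)

theorem gaussBinom_mul_prod_range {q : ℕ} (hq : 1 < q) (n k : ℕ) :
    gaussBinom q n k * ∏ i ∈ Finset.range k, ((q : ℚ) ^ k - (q : ℚ) ^ i) =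
      ∏ i ∈ Finset.range k, ((q : ℚ) ^ n - (q : ℚ) ^ i) := by
  have hq' : (1 : ℚ) < q := by exact_mod_cast hq
  rcases lt_or_ge n k with hlt | hle
  · rw [gaussBinom_eq_zero hlt, prod_range_pow_sub_pow_eq_zero _ hlt, zero_mul]
  · rw [gaussBinom, ← Finset.prod_mul_distrib]
    refine Finset.prod_congr rfl fun i hi => ?_
    have hi := Finset.mem_range.1 hi
    have h0 : (q : ℚ) ^ (k - i) - 1 ≠ 0 :=
      sub_ne_zero.2 (one_lt_pow₀ hq' (by omega)).ne'
    have h1 : (q : ℚ) ^ k = q ^ (k - i) * q ^ i := by rw [← pow_add]; congr 1; omega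
    have h2 : (q : ℚ) ^ n = q ^ (n - i) * q ^ i := by rw [← pow_add]; congr 1; omega
    rw [h1, h2]
    field_simp

variable {F V : Type*} [Field F] [AddCommGroup V] [Module F V]

/-- The pairs of a linearly independent `j`-tuple in `U ⊓ A` and a `k`-tuple in `U` that is linearly
independent modulo `A`. -/
def adaptedTuples (A U : Submodule F V) (j k : ℕ) : Set ((Fin j → V) × (Fin k → V)) :=
  {p | (LinearIndependent F p.1 ∧ ∀ i, p.1 i ∈ U ⊓ A) ∧
    LinearIndependent F (A.mkQ ∘ p.2) ∧ ∀ i, p.2 i ∈ U}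

/-- The tuples in the domain of a surjection `f` with linearly independent image are obtained from
the linearly independent tuples in the codomain by adding elements of the kernel to a lift. -/
theorem card_linearIndependent_comp {U Q : Type*} [AddCommGroup U] [Module F U] [AddCommGroup Q]
    [Module F Q] (f : U →ₗ[F] Q) (hf : LinearMap.range f = ⊤) (k : ℕ) :
    Nat.card {y : Fin k → U // LinearIndependent F (f ∘ y)} =
      Nat.card (LinearMap.ker f) ^ k * Nat.card {z : Fin k → Q // LinearIndependent F z} := by
  obtain ⟨g, hg⟩ := f.exists_rightInverse_of_surjective hf
  have hfg : ∀ z, f (g z) = z := fun z => LinearMap.congr_fun hg z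
  let e : {y : Fin k → U // LinearIndependent F (f ∘ y)} ≃
      (Fin k → LinearMap.ker f) × {z : Fin k → Q // LinearIndependent F z} :=
    { toFun := fun y => (fun i => ⟨y.1 i - g (f (y.1 i)), by simp [hfg]⟩, ⟨f ∘ y.1, y.2⟩)
      invFun := fun p => ⟨fun i => (p.1 i : U) + g (p.2.1 i), by
        have : f ∘ (fun i => (p.1 i : U) + g (p.2.1 i)) = p.2.1 := by
          funext i
          simp [hfg]
        rw [this]
        exact p.2.2⟩
      left_inv := fun y => by
        ext i
        simp
      right_inv := fun p => by
        ext i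
        · simp [hfg]
        · simp [hfg] }
  rw [Nat.card_congr e, Nat.card_prod, Nat.card_fun, Nat.card_fin]

variable [Finite F] [FiniteDimensional F V]

theorem card_linearIndependent_eq_prod_range (F V : Type*) [Field F] [AddCommGroup V] [Module F V]
    [Finite F] [FiniteDimensional F V] (k : ℕ) :
    (Nat.card {x : Fin k → V // LinearIndependent F x} : ℚ) =
      ∏ i ∈ Finset.range k, ((Nat.card F : ℚ) ^ finrank F V - (Nat.card F : ℚ) ^ i) := by
  have : Fintype F := Fintype.ofFinite F
  have : Finite V := Module.finite_of_finite F
  rcases le_or_gt k (finrank F V) with hle | hlt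
  · rw [card_linearIndependent hle, Nat.cast_prod, Finset.prod_range, Nat.card_eq_fintype_card]
    refine Finset.prod_congr rfl fun i _ => ?_
    rw [Nat.cast_sub (Nat.pow_le_pow_right Fintype.card_pos (i.2.le.trans hle))]
    push_cast
    rfl
  · rw [prod_range_pow_sub_pow_eq_zero _ hlt, Nat.cast_eq_zero]
    have : IsEmpty {x : Fin k → V // LinearIndependent F x} := ⟨fun x => by
      have := x.2.fintype_card_le_finrank
      rw [Fintype.card_fin] at this
      omega⟩
    exact Nat.card_of_isEmpty

theorem card_adaptedTuples (A U : Submodule F V) (j k : ℕ) {d e : ℕ}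
    (hd : finrank F (U ⊓ A : Submodule F V) = d) (he : finrank F U = d + e) :
    (Nat.card (adaptedTuples A U j k) : ℚ) =
      (∏ i ∈ Finset.range j, ((Nat.card F : ℚ) ^ d - (Nat.card F : ℚ) ^ i)) *
        ((Nat.card F : ℚ) ^ (d * k) *
          ∏ i ∈ Finset.range k, ((Nat.card F : ℚ) ^ e - (Nat.card F : ℚ) ^ i)) := by
  let f : U →ₗ[F] LinearMap.range (A.mkQ.comp U.subtype) :=
    (A.mkQ.comp U.subtype).rangeRestrict
  have hker : finrank F (LinearMap.ker f) = d := by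
    rw [LinearMap.ker_rangeRestrict, LinearMap.ker_comp, Submodule.ker_mkQ, ← hd,
      ← Submodule.map_comap_subtype, Submodule.finrank_map_subtype_eq]
  have hrange : finrank F (LinearMap.range (A.mkQ.comp U.subtype)) = e := by
    have h1 := LinearMap.finrank_range_add_finrank_ker (A.mkQ.comp U.subtype)
    rw [← LinearMap.ker_rangeRestrict] at h1
    change _ + finrank F (LinearMap.ker f) = _ at h1
    omega
  have hf : ∀ y : Fin k → U, LinearIndependent F (f ∘ y) ↔
      LinearIndependent F (A.mkQ ∘ fun i => (y i : V)) := by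
    intro y
    rw [← LinearMap.linearIndependent_iff (Submodule.subtype _) (Submodule.ker_subtype _)]
    rfl
  let e : adaptedTuples A U j k ≃
      {x : Fin j → (U ⊓ A : Submodule F V) // LinearIndependent F x} ×
        {y : Fin k → U // LinearIndependent F (f ∘ y)} :=
    { toFun := fun p => (⟨fun i => ⟨p.1.1 i, p.2.1.2 i⟩,
          (LinearMap.linearIndependent_iff (Submodule.subtype _) (Submodule.ker_subtype _)).1
            p.2.1.1⟩,
        ⟨fun i => ⟨p.1.2 i, p.2.2.2 i⟩, (hf _).2 p.2.2.1⟩)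
      invFun := fun p => ⟨(fun i => p.1.1 i, fun i => p.2.1 i),
        ⟨(LinearMap.linearIndependent_iff (Submodule.subtype _) (Submodule.ker_subtype _)).2
            p.1.2, fun i => (p.1.1 i).2⟩, (hf _).1 p.2.2, fun i => (p.2.1 i).2⟩
      left_inv := fun p => rfl
      right_inv := fun p => rfl }
  rw [Nat.card_congr e, Nat.card_prod, card_linearIndependent_comp f
    (LinearMap.range_rangeRestrict _) k, Nat.cast_mul, Nat.cast_mul,
    card_linearIndependent_eq_prod_range, card_linearIndependent_eq_prod_range, hd, hrange,
    Module.natCard_eq_pow_finrank (K := F) (V := LinearMap.ker f), hker]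
  push_cast
  rw [pow_mul]

omit [Finite F] in
theorem finrank_span_adaptedTuples {A U : Submodule F V} {j k : ℕ}
    {p : (Fin j → V) × (Fin k → V)} (hp : p ∈ adaptedTuples A U j k) :
    finrank F (Submodule.span F (Set.range p.1 ∪ Set.range p.2)) = j + k ∧
      finrank F (Submodule.span F (Set.range p.1 ∪ Set.range p.2) ⊓ A : Submodule F V) = j := by
  obtain ⟨⟨h₁, h₁A⟩, h₂, -⟩ := hp
  set W := Submodule.span F (Set.range p.1 ∪ Set.range p.2) with hW
  have hle : finrank F W ≤ j + k := by
    rw [hW, Submodule.span_union]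
    refine (Submodule.finrank_add_le_finrank_add_finrank _ _).trans (add_le_add ?_ ?_)
    · exact (finrank_range_le_card p.1).trans_eq (Fintype.card_fin j)
    · exact (finrank_range_le_card p.2).trans_eq (Fintype.card_fin k)
  have hj : j ≤ finrank F (W ⊓ A : Submodule F V) := by
    have h := finrank_span_eq_card h₁
    rw [Fintype.card_fin] at h
    rw [← h]
    refine Submodule.finrank_mono (le_inf (Submodule.span_mono Set.subset_union_left)
      (Submodule.span_le.2 ?_))
    rintro _ ⟨i, rfl⟩
    exact (h₁A i).2
  have hk : k ≤ finrank F (W.map A.mkQ) := by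
    have h := finrank_span_eq_card h₂
    rw [Fintype.card_fin] at h
    rw [← h]
    refine Submodule.finrank_mono (Submodule.span_le.2 ?_)
    rintro _ ⟨i, rfl⟩
    exact Submodule.mem_map_of_mem (Submodule.subset_span (Or.inr ⟨i, rfl⟩))
  have hsum : finrank F (W.map A.mkQ) + finrank F (W ⊓ A : Submodule F V) = finrank F W := by
    have h := LinearMap.finrank_range_add_finrank_ker (A.mkQ.comp W.subtype)
    rwa [LinearMap.range_comp, Submodule.range_subtype, LinearMap.ker_comp, Submodule.ker_mkQ,
      ← Submodule.finrank_map_subtype_eq W, Submodule.map_comap_subtype] at h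
  omega

/-- The number of subspaces of dimension `j + k` that meet an `a`-dimensional subspace of an
`(a + b)`-dimensional space in dimension `j`. Both sides, multiplied by the number of adapted tuples
of one such subspace, count all adapted tuples, since each of these spans exactly one. -/
theorem card_finrank_inf_eq (A : Submodule F V) {a b : ℕ} (ha : finrank F A = a)
    (hV : finrank F V = a + b) (j k : ℕ) :
    (Nat.card {U : Submodule F V //
        finrank F U = j + k ∧ finrank F (U ⊓ A : Submodule F V) = j} : ℚ) =
      (Nat.card F : ℚ) ^ ((a - j) * k) * gaussBinom (Nat.card F) a j *
        gaussBinom (Nat.card F) b k := by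
  have := finite_submodule F V
  have : Finite V := Module.finite_of_finite F
  have hspan : ∀ {U : Submodule F V}, finrank F U = j + k →
      ∀ {p : (Fin j → V) × (Fin k → V)}, p ∈ adaptedTuples A U j k →
      Submodule.span F (Set.range p.1 ∪ Set.range p.2) = U := by
    intro U hU p hp
    refine Submodule.eq_of_le_of_finrank_eq (Submodule.span_le.2 ?_)
      ((finrank_span_adaptedTuples hp).1.trans hU.symm)
    rintro _ (⟨i, rfl⟩ | ⟨i, rfl⟩)
    · exact (hp.1.2 i).1
    · exact hp.2.2 i
  let ψ : (Σ U : {U : Submodule F V //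
        finrank F U = j + k ∧ finrank F (U ⊓ A : Submodule F V) = j}, adaptedTuples A U.1 j k) →
      adaptedTuples A ⊤ j k := fun x =>
    ⟨x.2.1, ⟨x.2.2.1.1, fun i => ⟨trivial, (x.2.2.1.2 i).2⟩⟩, x.2.2.2.1, fun _ => trivial⟩
  have hψ : Function.Bijective ψ := by
    constructor
    · rintro ⟨⟨U, hU⟩, ⟨p, hp⟩⟩ ⟨⟨U', hU'⟩, ⟨p', hp'⟩⟩ h
      obtain rfl : p = p' := congrArg Subtype.val h
      obtain rfl : U = U' := (hspan hU.1 hp).symm.trans (hspan hU'.1 hp')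
      rfl
    · rintro ⟨p, hp⟩
      refine ⟨⟨⟨_, finrank_span_adaptedTuples hp⟩, ⟨p, ⟨hp.1.1, fun i => ⟨?_, (hp.1.2 i).2⟩⟩,
        hp.2.1, fun i => ?_⟩⟩, rfl⟩
      · exact Submodule.subset_span (Or.inl ⟨i, rfl⟩)
      · exact Submodule.subset_span (Or.inr ⟨i, rfl⟩)
  have hcount := Nat.card_congr (Equiv.ofBijective ψ hψ)
  have : Fintype {U : Submodule F V //
      finrank F U = j + k ∧ finrank F (U ⊓ A : Submodule F V) = j} := Fintype.ofFinite _
  rw [Nat.card_sigma] at hcount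
  have hcount' := congrArg (Nat.cast : ℕ → ℚ) hcount
  rw [Nat.cast_sum, Finset.sum_congr rfl fun U _ => card_adaptedTuples A U.1 j k U.2.2 U.2.1,
    Finset.sum_const, nsmul_eq_mul, Finset.card_univ, ← Nat.card_eq_fintype_card,
    card_adaptedTuples A ⊤ j k (d := a) (e := b) (by rw [top_inf_eq, ha])
      (by rw [finrank_top, hV])] at hcount'
  have hq : 1 < Nat.card F := Finite.one_lt_card
  have hq' : (1 : ℚ) < Nat.card F := by exact_mod_cast hq
  have hne : ∀ m : ℕ, ∏ i ∈ Finset.range m, ((Nat.card F : ℚ) ^ m - (Nat.card F : ℚ) ^ i) ≠ 0 :=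
    fun m => Finset.prod_ne_zero_iff.2 fun i hi =>
      sub_ne_zero.2 (pow_lt_pow_right₀ hq' (Finset.mem_range.1 hi)).ne'
  rw [← gaussBinom_mul_prod_range hq a j, ← gaussBinom_mul_prod_range hq b k] at hcount'
  have hpow : (Nat.card F : ℚ) ^ (j * k) ≠ 0 := by positivity
  refine mul_right_cancel₀ (mul_ne_zero (hne j) (mul_ne_zero hpow (hne k))) (hcount'.trans ?_)
  rcases le_or_gt j a with hja | haj
  · have : (Nat.card F : ℚ) ^ (a * k) =
        (Nat.card F : ℚ) ^ ((a - j) * k) * (Nat.card F : ℚ) ^ (j * k) := by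
      rw [← pow_add, ← add_mul, Nat.sub_add_cancel hja]
    rw [this]
    ring
  · rw [gaussBinom_eq_zero haj]
    ring

theorem card_finrank_eq (F V : Type*) [Field F] [AddCommGroup V] [Module F V] [Finite F]
    [FiniteDimensional F V] (k : ℕ) :
    (Nat.card {U : Submodule F V // finrank F U = k} : ℚ) =
      gaussBinom (Nat.card F) (finrank F V) k := by
  have h := card_finrank_inf_eq (⊥ : Submodule F V) (finrank_bot F V) (zero_add (finrank F V)).symm
    0 k
  simpa [gaussBinom] using h

/-- The number of `i`-dimensional subspaces of an `n`-dimensional space over the field with `q`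
elements that meet a given `a`-dimensional subspace in dimension at least `t`. -/
def layerCount (q n t a i : ℕ) : ℚ :=
  ∑ j ∈ Finset.Icc t i,
    (q : ℚ) ^ ((a - j) * (i - j)) * gaussBinom q a j * gaussBinom q (n - a) (i - j)

theorem crossBound_eq (q n t a : ℕ) (M : Finset ℕ) :
    crossBound q n t a M = 1 + ∑ i ∈ M, layerCount q n t a i := rfl

theorem ncard_meeting (t : ℕ) (M : Finset ℕ) (A : Submodule F V) :
    ((meeting t M A).ncard : ℚ) =
      ∑ i ∈ M, layerCount (Nat.card F) (finrank F V) t (finrank F A) i := by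
  classical
  have := finite_submodule F V
  have : Fintype (Submodule F V) := Fintype.ofFinite _
  have hmem : ∀ U : Submodule F V, U ∈ (meeting t M A).toFinset ↔
      finrank F U ∈ M ∧ t ≤ finrank F (U ⊓ A : Submodule F V) := fun U => Set.mem_toFinset
  rw [Set.ncard_eq_toFinset_card', Finset.card_eq_sum_card_fiberwise
    (f := fun U : Submodule F V => (⟨finrank F U, finrank F (U ⊓ A : Submodule F V)⟩ : Σ _ : ℕ, ℕ))
    (t := M.sigma fun i => Finset.Icc t i)]
  · simp only [layerCount]
    rw [Finset.sum_sigma', Nat.cast_sum]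
    refine Finset.sum_congr rfl fun x hx => ?_
    obtain ⟨i, j⟩ := x
    rw [Finset.mem_sigma, Finset.mem_Icc] at hx
    dsimp only at hx ⊢
    obtain ⟨hi, htj, hji⟩ := hx
    have hV : finrank F V = finrank F A + (finrank F V - finrank F A) := by
      have := Submodule.finrank_le A
      omega
    rw [← card_finrank_inf_eq A rfl hV j (i - j), Nat.card_eq_fintype_card, Fintype.card_subtype]
    congr 2
    ext U
    simp only [Finset.mem_filter, hmem, Finset.mem_univ, true_and, Sigma.mk.injEq, heq_eq_eq]
    constructor
    · rintro ⟨-, h1, h2⟩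
      exact ⟨by omega, h2⟩
    · rintro ⟨h1, h2⟩
      have h3 : finrank F U = i := by omega
      exact ⟨⟨h3 ▸ hi, h2 ▸ htj⟩, h3, h2⟩
  · intro U hU
    rw [Finset.mem_coe, hmem] at hU
    simp only [Finset.coe_sigma, Set.mem_sigma_iff, Finset.mem_coe, Finset.mem_Icc]
    exact ⟨hU.1, hU.2, Submodule.finrank_mono inf_le_left⟩

end Counting

/-! ### Comparison of the two bounds -/

section Comparison

theorem gaussBinom_nonneg {q : ℕ} (hq : 1 < q) (n k : ℕ) : 0 ≤ gaussBinom q n k := by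
  have hq' : (1 : ℚ) ≤ q := by exact_mod_cast hq.le
  exact Finset.prod_nonneg fun i _ =>
    div_nonneg (sub_nonneg.2 (one_le_pow₀ hq')) (sub_nonneg.2 (one_le_pow₀ hq'))

theorem gaussBinom_pos {q : ℕ} (hq : 1 < q) {n k : ℕ} (hkn : k ≤ n) : 0 < gaussBinom q n k := by
  have hq' : (1 : ℚ) < q := by exact_mod_cast hq
  refine Finset.prod_pos fun i hi => ?_
  have hi := Finset.mem_range.1 hi
  exact div_pos (sub_pos.2 (one_lt_pow₀ hq' (by omega))) (sub_pos.2 (one_lt_pow₀ hq' (by omega)))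

theorem gaussBinom_succ_mul {q : ℕ} (hq : 1 < q) (n k : ℕ) :
    gaussBinom q n (k + 1) * ((q : ℚ) ^ (k + 1) - 1) =
      gaussBinom q n k * ((q : ℚ) ^ (n - k) - 1) := by
  have hq' : (1 : ℚ) < q := by exact_mod_cast hq
  have hne : ∀ m : ℕ, ∏ i ∈ Finset.range m, ((q : ℚ) ^ (m - i) - 1) ≠ 0 := fun m =>
    Finset.prod_ne_zero_iff.2 fun i hi => by
      have := Finset.mem_range.1 hi
      exact sub_ne_zero.2 (one_lt_pow₀ hq' (by omega)).ne'
  have hden : ∏ i ∈ Finset.range (k + 1), ((q : ℚ) ^ (k + 1 - i) - 1) =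
      (∏ i ∈ Finset.range k, ((q : ℚ) ^ (k - i) - 1)) * ((q : ℚ) ^ (k + 1) - 1) := by
    rw [Finset.prod_range_succ']
    simp
  have h1 := hne (k + 1)
  rw [hden] at h1
  have h2 := right_ne_zero_of_mul h1
  have h3 := hne k
  rw [gaussBinom, gaussBinom, Finset.prod_div_distrib, Finset.prod_div_distrib, hden,
    Finset.prod_range_succ]
  field_simp

theorem two_mul_gaussBinom_le {q : ℕ} (hq : 1 < q) {n k : ℕ} (h : 2 * k + 2 ≤ n) :
    2 * gaussBinom q n k ≤ gaussBinom q n (k + 1) := by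
  have hq' : (2 : ℚ) ≤ q := by exact_mod_cast hq
  have hpos : (0 : ℚ) < (q : ℚ) ^ (k + 1) - 1 :=
    sub_pos.2 (one_lt_pow₀ (by linarith) (by omega))
  refine le_of_mul_le_mul_right ?_ hpos
  rw [gaussBinom_succ_mul hq, mul_comm 2, mul_assoc]
  refine mul_le_mul_of_nonneg_left ?_ (gaussBinom_nonneg hq n k)
  have h1 : (q : ℚ) ^ (k + 2) ≤ (q : ℚ) ^ (n - k) :=
    pow_le_pow_right₀ (by linarith) (by omega)
  have h2 : 2 * (q : ℚ) ^ (k + 1) ≤ (q : ℚ) ^ (k + 2) := by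
    rw [pow_succ _ (k + 1), mul_comm]
    exact mul_le_mul_of_nonneg_left hq' (by positivity)
  linarith

theorem two_mul_gaussBinom_le_of_lt {q : ℕ} (hq : 1 < q) {n r s : ℕ} (hrs : r < s)
    (hs : 2 * s ≤ n) : 2 * gaussBinom q n r ≤ gaussBinom q n s := by
  induction s, hrs using Nat.le_induction with
  | base => exact two_mul_gaussBinom_le hq (by omega)
  | succ s _ ih =>
    have h1 := ih (by omega)
    have h2 := two_mul_gaussBinom_le hq (n := n) (k := s) (by omega)
    have h3 := gaussBinom_nonneg hq n s
    linarith

theorem layerCount_nonneg {q : ℕ} (hq : 1 < q) (n t a i : ℕ) : 0 ≤ layerCount q n t a i :=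
  Finset.sum_nonneg fun _ _ => mul_nonneg (mul_nonneg (by positivity) (gaussBinom_nonneg hq _ _))
    (gaussBinom_nonneg hq _ _)

theorem layerCount_self_pos {q : ℕ} (hq : 1 < q) (n : ℕ) {t a : ℕ} (hta : t ≤ a) :
    0 < layerCount q n t a t := by
  have hq0 : (0 : ℚ) < q := by exact_mod_cast (zero_lt_one.trans hq)
  simp only [layerCount, Finset.Icc_self, Finset.sum_singleton]
  exact mul_pos (mul_pos (pow_pos hq0 _) (gaussBinom_pos hq hta))
    (gaussBinom_pos hq (by omega))

theorem two_mul_layerCount_le {q : ℕ} (hq : 1 < q) {n t a i : ℕ} (ht : 0 < t)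
    (h : a + 2 * i ≤ n) : 2 * layerCount q n t a i ≤ layerCount q n t a (i + 1) := by
  have hq1 : (1 : ℚ) ≤ q := by exact_mod_cast hq.le
  have hterm : ∀ i j, 0 ≤ (q : ℚ) ^ ((a - j) * (i - j)) * gaussBinom q a j *
      gaussBinom q (n - a) (i - j) := fun i j =>
    mul_nonneg (mul_nonneg (by positivity) (gaussBinom_nonneg hq _ _)) (gaussBinom_nonneg hq _ _)
  refine le_trans ?_ (Finset.sum_le_sum_of_subset_of_nonneg
    (Finset.Icc_subset_Icc_right (Nat.le_succ i)) fun j _ _ => hterm (i + 1) j)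
  rw [layerCount, Finset.mul_sum]
  refine Finset.sum_le_sum fun j hj => ?_
  rw [Finset.mem_Icc] at hj
  have hij : i + 1 - j = (i - j) + 1 := by omega
  have h1 := two_mul_gaussBinom_le hq (n := n - a) (k := i - j) (by omega)
  have h2 : (q : ℚ) ^ ((a - j) * (i - j)) ≤ (q : ℚ) ^ ((a - j) * (i - j + 1)) :=
    pow_le_pow_right₀ hq1 (Nat.mul_le_mul_left _ (Nat.le_succ _))
  rw [hij]
  calc 2 * ((q : ℚ) ^ ((a - j) * (i - j)) * gaussBinom q a j * gaussBinom q (n - a) (i - j))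
      = (q : ℚ) ^ ((a - j) * (i - j)) * gaussBinom q a j *
          (2 * gaussBinom q (n - a) (i - j)) := by ring
    _ ≤ _ := mul_le_mul (mul_le_mul_of_nonneg_right h2 (gaussBinom_nonneg hq _ _)) h1
        (mul_nonneg zero_le_two (gaussBinom_nonneg hq _ _))
        (mul_nonneg (by positivity) (gaussBinom_nonneg hq _ _))

theorem sum_Ico_lt_of_two_mul_le {f : ℕ → ℚ} {t k : ℕ} (htk : t ≤ k) (hpos : 0 < f t)
    (h : ∀ i < k, t ≤ i → 2 * f i ≤ f (i + 1)) : ∑ i ∈ Finset.Ico t k, f i < f k := by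
  induction k, htk using Nat.le_induction with
  | base => simpa using hpos
  | succ k hk ih =>
    rw [Finset.sum_Ico_succ_top hk]
    have h1 := ih fun i hi => h i (by omega)
    have h2 := h k (Nat.lt_succ_self k) hk
    linarith

/-- Both sides count the pairs of an `r`-dimensional and an `s`-dimensional subspace that meet in
dimension at least `t`. -/
theorem gaussBinom_mul_layerCount (F V : Type*) [Field F] [AddCommGroup V] [Module F V] [Finite F]
    [FiniteDimensional F V] (t r s : ℕ) :
    gaussBinom (Nat.card F) (finrank F V) r * layerCount (Nat.card F) (finrank F V) t r s =
      gaussBinom (Nat.card F) (finrank F V) s * layerCount (Nat.card F) (finrank F V) t s r := by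
  classical
  have := finite_submodule F V
  have : Fintype (Submodule F V) := Fintype.ofFinite _
  have hcard : ∀ k, ((Finset.univ.filter fun U : Submodule F V => finrank F U = k).card : ℚ) =
      gaussBinom (Nat.card F) (finrank F V) k := fun k => by
    rw [← card_finrank_eq, Nat.card_eq_fintype_card, Fintype.card_subtype]
  have hmeet : ∀ (a i : ℕ) (A : Submodule F V), finrank F A = a →
      ((Finset.univ.filter fun U : Submodule F V =>
        finrank F U = i ∧ t ≤ finrank F (U ⊓ A : Submodule F V)).card : ℚ) =
      layerCount (Nat.card F) (finrank F V) t a i := by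
    rintro a i A rfl
    have h := ncard_meeting t {i} A
    rw [Finset.sum_singleton] at h
    rw [← h, Set.ncard_eq_toFinset_card']
    congr 2
    ext U
    rw [Finset.mem_filter, Set.mem_toFinset]
    simp [meeting, subspacesOfDim]
  have hdc := Finset.sum_card_bipartiteAbove_eq_sum_card_bipartiteBelow
    (s := Finset.univ.filter fun U : Submodule F V => finrank F U = r)
    (t := Finset.univ.filter fun U : Submodule F V => finrank F U = s)
    (fun A B => t ≤ finrank F (A ⊓ B : Submodule F V))
  have habove : ∀ A ∈ Finset.univ.filter fun U : Submodule F V => finrank F U = r,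
      (((Finset.univ.filter fun U : Submodule F V => finrank F U = s).bipartiteAbove
        (fun A B => t ≤ finrank F (A ⊓ B : Submodule F V)) A).card : ℚ) =
      layerCount (Nat.card F) (finrank F V) t r s := fun A hA => by
    rw [← hmeet r s A (Finset.mem_filter.1 hA).2, Finset.bipartiteAbove, Finset.filter_filter]
    congr 2
    ext U
    rw [Finset.mem_filter, Finset.mem_filter, inf_comm]
  have hbelow : ∀ B ∈ Finset.univ.filter fun U : Submodule F V => finrank F U = s,
      (((Finset.univ.filter fun U : Submodule F V => finrank F U = r).bipartiteBelow
        (fun A B => t ≤ finrank F (A ⊓ B : Submodule F V)) B).card : ℚ) =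
      layerCount (Nat.card F) (finrank F V) t s r := fun B hB => by
    rw [← hmeet s r B (Finset.mem_filter.1 hB).2, Finset.bipartiteBelow, Finset.filter_filter]
  have hdc' := congrArg (Nat.cast : ℕ → ℚ) hdc
  rwa [Nat.cast_sum, Nat.cast_sum, Finset.sum_congr rfl habove, Finset.sum_congr rfl hbelow,
    Finset.sum_const, Finset.sum_const, nsmul_eq_mul, nsmul_eq_mul, hcard, hcard] at hdc'

/-- If the largest dimension that belongs to just one of `R` and `S` belongs to `S`, the bound for a
single `r`-dimensional left member is the larger one. The number of subspaces of dimension `i` that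
meet a fixed subspace suitably at least doubles with each step of `i`, so the layers in `R \ S` are
outweighed by a single layer of `S`. -/
theorem crossBound_lt_crossBound (F V : Type*) [Field F] [AddCommGroup V] [Module F V] [Finite F]
    [FiniteDimensional F V] {t r s m : ℕ} {R S : Finset ℕ} (ht : 0 < t) (htR : ∀ i ∈ R, t ≤ i)
    (htS : ∀ i ∈ S, t ≤ i) (hR : IsGreatest (R : Set ℕ) r) (hS : IsGreatest (S : Set ℕ) s)
    (hn : s ^ 2 + r ^ 2 + s * r ≤ finrank F V) (hmS : m ∈ S) (hmR : m ∉ R)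
    (hm : ∀ x ∈ R, x ∉ S → x ≤ m) :
    crossBound (Nat.card F) (finrank F V) t s R < crossBound (Nat.card F) (finrank F V) t r S := by
  have hq : 1 < Nat.card F := Finite.one_lt_card
  set q := Nat.card F with hqdef
  set n := finrank F V with hndef
  have htr : t ≤ r := htR r hR.1
  have hts : t ≤ s := htS s hS.1
  have hnn := fun a i => layerCount_nonneg hq n t a i
  have hrs : r ≤ s := by
    by_contra hlt
    have hrS : r ∉ S := fun h => hlt (hS.2 h)
    exact hlt ((hm r hR.1 hrS).trans (hS.2 hmS))
  have hr2 : r ≤ r ^ 2 := Nat.le_self_pow two_ne_zero r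
  have hs2 : s ≤ s ^ 2 := Nat.le_self_pow two_ne_zero s
  have hsr : s ≤ s * r := Nat.le_mul_of_pos_right s (by omega)
  rw [crossBound_eq, crossBound_eq, add_lt_add_iff_left]
  rcases hrs.eq_or_lt with rfl | hlt
  · have hmr : m < r := lt_of_le_of_ne (hS.2 hmS) fun h => hmR (h ▸ hR.1)
    rw [← Finset.sum_inter_add_sum_sdiff R S, ← Finset.sum_inter_add_sum_sdiff S R,
      Finset.inter_comm S R, add_lt_add_iff_left]
    calc ∑ i ∈ R \ S, layerCount q n t r i ≤ ∑ i ∈ Finset.Ico t m, layerCount q n t r i := by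
          refine Finset.sum_le_sum_of_subset_of_nonneg (fun i hi => ?_) fun i _ _ => hnn r i
          obtain ⟨hiR, hiS⟩ := Finset.mem_sdiff.1 hi
          exact Finset.mem_Ico.2 ⟨htR i hiR, lt_of_le_of_ne (hm i hiR hiS)
            fun h => hiS (h ▸ hmS)⟩
      _ < layerCount q n t r m := sum_Ico_lt_of_two_mul_le (htS m hmS)
          (layerCount_self_pos hq n htr) fun i hi _ => two_mul_layerCount_le hq ht (by omega)
      _ ≤ _ := Finset.single_le_sum (f := fun i => layerCount q n t r i) (fun i _ => hnn r i)
          (Finset.mem_sdiff.2 ⟨hmS, hmR⟩)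
  · have hpos := gaussBinom_pos hq (n := n) (k := r) (by omega)
    have hbin := two_mul_gaussBinom_le_of_lt hq hlt (n := n) (by omega)
    have hdc := gaussBinom_mul_layerCount F V t r s
    have hdouble : 2 * layerCount q n t s r ≤ layerCount q n t r s := by
      refine le_of_mul_le_mul_left ?_ hpos
      rw [hdc]
      have := mul_le_mul_of_nonneg_right hbin (hnn s r)
      linarith
    have hsum : ∑ i ∈ Finset.Ico t r, layerCount q n t s i < layerCount q n t s r :=
      sum_Ico_lt_of_two_mul_le htr (layerCount_self_pos hq n hts) fun i hi _ =>
        two_mul_layerCount_le hq ht (by omega)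
    calc ∑ i ∈ R, layerCount q n t s i ≤ ∑ i ∈ Finset.Ico t (r + 1), layerCount q n t s i :=
          Finset.sum_le_sum_of_subset_of_nonneg (fun i hi => Finset.mem_Ico.2
            ⟨htR i hi, Nat.lt_succ_of_le (hR.2 hi)⟩) fun i _ _ => hnn s i
      _ < layerCount q n t r s := by
          rw [Finset.sum_Ico_succ_top htr]
          linarith
      _ ≤ _ := Finset.single_le_sum (f := fun i => layerCount q n t r i) (fun i _ => hnn r i) hS.1

end Comparison

/-! ### The bound and the case of equality -/

theorem IsTrivialPair.ncard_add {F V : Type*} [Field F] [Finite F] [AddCommGroup V] [Module F V]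
    [FiniteDimensional F V] {t a : ℕ} {M : Finset ℕ} {𝒜 ℬ : Set (Submodule F V)}
    (h : IsTrivialPair t a M 𝒜 ℬ) :
    (𝒜.ncard : ℚ) + ℬ.ncard = crossBound (Nat.card F) (finrank F V) t a M := by
  obtain ⟨A, rfl, rfl, rfl⟩ := h
  rw [crossBound_eq, ← ncard_meeting, Set.ncard_singleton, Nat.cast_one]
  rfl

theorem theorem2 {F V : Type*} [Field F] [Finite F] [AddCommGroup V] [Module F V]
    [FiniteDimensional F V] (n r s t : ℕ)
    (hn : 0 < n) (hr : 0 < r) (hs : 0 < s) (ht : 0 < t) (hV : finrank F V = n)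
    (R S : Finset ℕ) (hRn : R ⊆ Finset.Icc 1 n) (hSn : S ⊆ Finset.Icc 1 n)
    (htRS : ∀ i ∈ R ∪ S, t ≤ i)
    (hrR : IsGreatest (R : Set ℕ) r) (hsS : IsGreatest (S : Set ℕ) s)
    (hrst : r + s < n + t)
    (𝒜 ℬ : Set (Submodule F V))
    (h𝒜 : 𝒜 ⊆ subspacesOfDim F V R) (hℬ : ℬ ⊆ subspacesOfDim F V S)
    (hcross : NonemptyCrossIntersecting t 𝒜 ℬ) :
    (𝒜.ncard : ℚ) + (ℬ.ncard : ℚ) ≤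
        max (crossBound (Nat.card F) n t r S) (crossBound (Nat.card F) n t s R) ∧
    (R = S →
      ((𝒜.ncard : ℚ) + (ℬ.ncard : ℚ) =
          max (crossBound (Nat.card F) n t r S) (crossBound (Nat.card F) n t s R) ↔
        IsTrivialPair t r S 𝒜 ℬ ∨ IsTrivialPair t s R ℬ 𝒜)) ∧
    (R ≠ S → s ^ 2 + r ^ 2 + s * r ≤ n →
      ((𝒜.ncard : ℚ) + (ℬ.ncard : ℚ) =
          max (crossBound (Nat.card F) n t r S) (crossBound (Nat.card F) n t s R) ↔
        ((∃ m ∈ S, IsGreatest (symmDiff R S : Set ℕ) m) ∧ IsTrivialPair t r S 𝒜 ℬ) ∨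
        ((∃ m ∈ R, IsGreatest (symmDiff R S : Set ℕ) m) ∧ IsTrivialPair t s R ℬ 𝒜))) := by
  subst hV
  have htR : ∀ i ∈ R, t ≤ i := fun i hi => htRS i (Finset.mem_union_left S hi)
  have htS : ∀ i ∈ S, t ≤ i := fun i hi => htRS i (Finset.mem_union_right R hi)
  have hrV : r ≤ finrank F V := (Finset.mem_Icc.1 (hRn hrR.1)).2
  have hsV : s ≤ finrank F V := (Finset.mem_Icc.1 (hSn hsS.1)).2
  have hpair : IsCrossPair t R S 𝒜 ℬ := ⟨h𝒜, hℬ, hcross⟩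
  have htriv : ∀ 𝒜' ℬ' : Set (Submodule F V), IsMaxCrossPair t R S 𝒜' ℬ' →
      IsTrivialPair t r S 𝒜' ℬ' ∨ IsTrivialPair t s R ℬ' 𝒜' := fun 𝒜' ℬ' h =>
    h.isTrivialPair_or ht htR htS hrR hsS hrV hsV hrst
  have hbound : ∀ 𝒜' ℬ' : Set (Submodule F V), IsCrossPair t R S 𝒜' ℬ' →
      (𝒜'.ncard : ℚ) + (ℬ'.ncard : ℚ) ≤ max (crossBound (Nat.card F) (finrank F V) t r S)
        (crossBound (Nat.card F) (finrank F V) t s R) := by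
    intro 𝒜' ℬ' h
    obtain ⟨𝒞, 𝒟, hmax⟩ := h.exists_isMaxCrossPair
    have hle : (𝒜'.ncard : ℚ) + (ℬ'.ncard : ℚ) ≤ (𝒞.ncard : ℚ) + (𝒟.ncard : ℚ) := by
      exact_mod_cast hmax.ncard_add_le _ _ h
    rcases htriv _ _ hmax with h' | h'
    · exact (hle.trans_eq h'.ncard_add).trans (le_max_left _ _)
    · exact (hle.trans_eq ((add_comm _ _).trans h'.ncard_add)).trans (le_max_right _ _)
  have heq : (𝒜.ncard : ℚ) + (ℬ.ncard : ℚ) =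
      max (crossBound (Nat.card F) (finrank F V) t r S)
        (crossBound (Nat.card F) (finrank F V) t s R) →
      IsTrivialPair t r S 𝒜 ℬ ∨ IsTrivialPair t s R ℬ 𝒜 := fun h =>
    htriv _ _ ⟨hpair, fun 𝒜' ℬ' h' => by exact_mod_cast (hbound 𝒜' ℬ' h').trans_eq h.symm⟩
  refine ⟨hbound _ _ hpair, ?_, fun hne hlarge => ?_⟩
  · rintro rfl
    obtain rfl := hrR.unique hsS
    rw [max_self] at heq ⊢
    refine ⟨heq, ?_⟩
    rintro (h | h)
    · exact h.ncard_add
    · exact (add_comm _ _).trans h.ncard_add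
  · have hltS : ∀ m ∈ S, IsGreatest (symmDiff R S : Set ℕ) m →
        crossBound (Nat.card F) (finrank F V) t s R <
          crossBound (Nat.card F) (finrank F V) t r S := by
      intro m hmS hm
      have hmR : m ∉ R := fun hmR => by
        rcases Set.mem_symmDiff.1 hm.1 with h | h
        · exact h.2 hmS
        · exact h.2 hmR
      exact crossBound_lt_crossBound F V ht htR htS hrR hsS hlarge hmS hmR
        fun x hxR hxS => hm.2 (Set.mem_symmDiff.2 (Or.inl ⟨hxR, hxS⟩))
    have hltR : ∀ m ∈ R, IsGreatest (symmDiff R S : Set ℕ) m →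
        crossBound (Nat.card F) (finrank F V) t r S <
          crossBound (Nat.card F) (finrank F V) t s R := by
      intro m hmR hm
      have hmS : m ∉ S := fun hmS => by
        rcases Set.mem_symmDiff.1 hm.1 with h | h
        · exact h.2 hmS
        · exact h.2 hmR
      exact crossBound_lt_crossBound F V ht htS htR hsS hrR (by linarith) hmR hmS
        fun x hxS hxR => hm.2 (Set.mem_symmDiff.2 (Or.inr ⟨hxS, hxR⟩))
    constructor
    · intro h
      obtain ⟨m, hm⟩ : ∃ m, IsGreatest (symmDiff R S : Set ℕ) m := by
        have hD : (symmDiff R S).Nonempty := by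
          rw [Finset.nonempty_iff_ne_empty]
          exact fun h0 => hne (symmDiff_eq_bot.1 h0)
        have := (symmDiff R S).isGreatest_max' hD
        rw [Finset.coe_symmDiff] at this
        exact ⟨_, this⟩
      have hmem : m ∈ S ∨ m ∈ R := (Set.mem_symmDiff.1 hm.1).elim (fun h => Or.inr h.1)
        fun h => Or.inl h.1
      rcases hmem with hmS | hmR
      · refine Or.inl ⟨⟨m, hmS, hm⟩, (heq h).resolve_right fun h' => ?_⟩
        have hlt := hltS m hmS hm
        rw [max_eq_left hlt.le, add_comm, h'.ncard_add] at h
        exact hlt.ne h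
      · refine Or.inr ⟨⟨m, hmR, hm⟩, (heq h).resolve_left fun h' => ?_⟩
        have hlt := hltR m hmR hm
        rw [max_eq_right hlt.le, h'.ncard_add] at h
        exact hlt.ne h
    · rintro (⟨⟨m, hmS, hm⟩, h⟩ | ⟨⟨m, hmR, hm⟩, h⟩)
      · rw [max_eq_left (hltS m hmS hm).le, h.ncard_add]
      · rw [max_eq_right (hltR m hmR hm).le, add_comm, h.ncard_add]
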